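/- **Setting.** Let $X_1,X_2,\dots$ be nonempty finite sets with $|X_1|<|X_2|<\cdots$, let $\omega$ be a nonprincipal ultrafilter on $\mathbb N$, and let $k$ be a natural number; write $[k]=\{1,\dots,k\}$. For a sequence of nonempty finite sets $Y_1,Y_2,\dots$ let $\mathbf Y=\prod_i Y_i/\omega$ be the ultraproduct, whose points are the classes $[\{p_i\}]$ of sequences $p_i\in Y_i$ modulo equality for $\omega$-almost all $i$. For $A_i\subseteq Y_i$ the *ultraproduct set* $[\{A_i\}]\subseteq\mathbf Y$ consists of the classes $[\{p_i\}]$ with $\{i: p_i\in A_i\}\in\omega$, and $\mu([\{A_i\}])=\lim_\omega |A_i|/|Y_i|$. A set $N\subseteq\mathbf Y$ is a *nullset* if for every $\varepsilon>0$ it is contained in an ultraproduct set of measure at most $\varepsilon$. A set $B\subseteq\mathbf Y$ is *measurable* if $B\triangle\widetilde B$ is a nullset for some ultraproduct set $\widetilde B$, and then $\mu(B)=\mu(\widetilde B)$. The measurable sets form a $\sigma$-algebra on which $\mu$ is a probability measure. For $A\subseteq[k]$ let $\mathbf X^A$ be the ultraproduct of the sets $X_i^A$, with $\sigma$-algebra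 $\mathcal B_A$ of measurable sets, let $p_A:\mathbf X^{[k]}\to\mathbf X^A$ be the projection, and let $\sigma(A)=p_A^{-1}(\mathcal B_A)$, a $\sigma$-algebra of measurable subsets of $\mathbf X^{[k]}$. For nonempty $A$ let $\sigma(A)^*$ be the $\sigma$-algebra generated by all $\sigma(B)$ with $B\subseteq A$ and $|B|=|A|-1$. Let $\mu$ be the above probability measure on $\mathbf X^{[k]}$; write $E(S\mid\mathcal C)$ for the conditional expectation, with respect to $\mu$, of the characteristic function of a measurable set $S$ given a sub-$\sigma$-algebra $\mathcal C$. **Theorem (Total Independence Theorem).** Let $A_1,\dots,A_r$ be distinct nonempty subsets of $[k]$, and let $S_1,\dots,S_r\subseteq\mathbf X^{[k]}$ be such that, for every $1\le i\le r$, $S_i\in\sigma(A_i)$ and $E(S_i\mid\sigma(A_i)^*)$ is ($\mu$-almost everywhere) a constant function. Then $$\mu(S_1\cap S_2\cap\cdots\cap S_r)=\mu(S_1)\mu(S_2)\cdots\mu(S_r).$$ -/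

import Mathlib

open MeasureTheory Filter Topology

namespace UltraLoeb

noncomputable section

/-- The normalized counting measure of a subset of a finite set. -/
def density {Z : Type*} (A : Set Z) : ℝ := (A.ncard : ℝ) / (Nat.card Z : ℝ)

section density
variable {Z : Type*}

theorem density_nonneg (A : Set Z) : 0 ≤ density A := by
  unfold density; positivity

theorem density_mono [Finite Z] {A B : Set Z} (h : A ⊆ B) : density A ≤ density B := by
  unfold density
  gcongr
  exact Set.toFinite B

theorem density_univ [Finite Z] [Nonempty Z] : density (Set.univ : Set Z) = 1 := by
  unfold density
  rw [Set.ncard_univ]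
  exact div_self (by exact_mod_cast Nat.card_pos.ne')

theorem density_empty : density (∅ : Set Z) = 0 := by
  simp [density]

theorem density_le_one [Finite Z] [Nonempty Z] (A : Set Z) : density A ≤ 1 := by
  rw [← density_univ (Z := Z)]
  exact density_mono (Set.subset_univ A)

theorem density_union_add_inter [Finite Z] (A B : Set Z) :
    density (A ∪ B) + density (A ∩ B) = density A + density B := by
  unfold density
  rw [← add_div, ← add_div]
  congr 1
  exact_mod_cast Set.ncard_union_add_ncard_inter A B

end density

section ultra
variable (ω : Ultrafilter ℕ) {Y : ℕ → Type*}

/-- The class of a sequence in the ultraproduct. -/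
def mk (p : ∀ i, Y i) : (ω : Filter ℕ).Product Y := Quotient.mk _ p

theorem mk_ind {P : (ω : Filter ℕ).Product Y → Prop} (h : ∀ p, P (mk ω p)) (q) : P q :=
  Quotient.ind h q

/-- The ultraproduct `[{A_i}]` of a sequence of sets `A_i ⊆ Y_i`, as a subset of the ultraproduct
of the `Y_i`: the class of `p` belongs to it when `p_i ∈ A_i` for `ω`-almost all `i`. -/
def ultraSet (A : ∀ i, Set (Y i)) : Set ((ω : Filter ℕ).Product Y) :=
  {q | Quotient.liftOn q (fun p : ∀ i, Y i => ∀ᶠ i in (ω : Filter ℕ), p i ∈ A i)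
    (fun p p' (h : ∀ᶠ i in (ω : Filter ℕ), p i = p' i) => propext
      ⟨fun hp => by filter_upwards [h, hp] with i h1 h2; rwa [← h1],
       fun hp => by filter_upwards [h, hp] with i h1 h2; rwa [h1]⟩)}

/-- The measure of the ultraproduct set `[{A_i}]`: the ultralimit of `|A_i| / |Y_i|`. -/
def ultraDensity (A : ∀ i, Set (Y i)) : ℝ :=
  limUnder (ω : Filter ℕ) (fun i => density (A i))

/-- Nullsets: sets covered by ultraproduct sets of arbitrarily small measure. -/
def IsNullset (N : Set ((ω : Filter ℕ).Product Y)) : Prop :=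
  ∀ ε : ℝ, 0 < ε → ∃ A : ∀ i, Set (Y i), N ⊆ ultraSet ω A ∧ ultraDensity ω A ≤ ε

/-- `[{A_i}]` approximates `B` up to a nullset. -/
def Approx (B : Set ((ω : Filter ℕ).Product Y)) (A : ∀ i, Set (Y i)) : Prop :=
  IsNullset ω (symmDiff B (ultraSet ω A))

/-- Measurable sets: those which differ from an ultraproduct set by a nullset. -/
def IsMeas (B : Set ((ω : Filter ℕ).Product Y)) : Prop :=
  ∃ A : ∀ i, Set (Y i), Approx ω B A

variable {ω}

theorem mk_mem_ultraSet {A : ∀ i, Set (Y i)} {p : ∀ i, Y i} :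
    mk ω p ∈ ultraSet ω A ↔
      ∀ᶠ i in (ω : Filter ℕ), p i ∈ A i := Iff.rfl

theorem ultraSet_compl (A : ∀ i, Set (Y i)) :
    ultraSet ω (fun i => (A i)ᶜ) = (ultraSet ω A)ᶜ := by
  ext q
  induction q using mk_ind with
  | h p => exact Ultrafilter.eventually_not

theorem ultraSet_union (A B : ∀ i, Set (Y i)) :
    ultraSet ω (fun i => A i ∪ B i) = ultraSet ω A ∪ ultraSet ω B := by
  ext q
  induction q using mk_ind with
  | h p => exact Ultrafilter.eventually_or

theorem ultraSet_inter (A B : ∀ i, Set (Y i)) :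
    ultraSet ω (fun i => A i ∩ B i) = ultraSet ω A ∩ ultraSet ω B := by
  ext q
  induction q using mk_ind with
  | h p => exact Filter.eventually_and

theorem ultraSet_empty : ultraSet ω (fun i => (∅ : Set (Y i))) = ∅ := by
  ext q
  induction q using mk_ind with
  | h p => simp [mk_mem_ultraSet, ω.neBot.ne]

theorem ultraSet_univ : ultraSet ω (fun i => (Set.univ : Set (Y i))) = Set.univ := by
  ext q
  induction q using mk_ind with
  | h p => simp [mk_mem_ultraSet]

theorem ultraSet_subset_iff [∀ i, Nonempty (Y i)] {A B : ∀ i, Set (Y i)} :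
    ultraSet ω A ⊆ ultraSet ω B ↔ ∀ᶠ i in (ω : Filter ℕ), A i ⊆ B i := by
  constructor
  · intro h
    by_contra hc
    rw [← Ultrafilter.eventually_not] at hc
    have hch : ∀ i, ∃ p : Y i, ¬ A i ⊆ B i → p ∈ A i ∧ p ∉ B i := by
      intro i
      by_cases hi : A i ⊆ B i
      · exact ⟨Classical.arbitrary _, fun h => absurd hi h⟩
      · obtain ⟨p, hp1, hp2⟩ := Set.not_subset.1 hi
        exact ⟨p, fun _ => ⟨hp1, hp2⟩⟩
    choose p hp using hch
    have h1 : mk ω p ∈ ultraSet ω A := by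
      rw [mk_mem_ultraSet]
      filter_upwards [hc] with i hi using (hp i hi).1
    have h2 := mk_mem_ultraSet.1 (h h1)
    obtain ⟨i, hi1, hi2⟩ := (h2.and hc).exists
    exact (hp i hi2).2 hi1
  · intro h q
    induction q using mk_ind with
    | h p =>
      intro hq
      rw [mk_mem_ultraSet] at hq ⊢
      filter_upwards [h, hq] with i h1 h2 using h1 h2

theorem IsNullset.subset {N M : Set ((ω : Filter ℕ).Product Y)} (hM : IsNullset ω M)
    (h : N ⊆ M) : IsNullset ω N := by
  intro ε hε
  obtain ⟨A, hA, hA'⟩ := hM ε hε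
  exact ⟨A, h.trans hA, hA'⟩

/-- Partial unions of a sequence of sequences of sets. -/
def partialUnion (A : ℕ → ∀ i, Set (Y i)) (l : ℕ) (i : ℕ) : Set (Y i) :=
  match l with
  | 0 => ∅
  | n + 1 => partialUnion A n i ∪ A n i

theorem partialUnion_mono (A : ℕ → ∀ i, Set (Y i)) (i : ℕ) :
    Monotone fun l => partialUnion A l i :=
  monotone_nat_of_le_succ fun _ => Set.subset_union_left

theorem ultraSet_partialUnion_succ (A : ℕ → ∀ i, Set (Y i)) (l : ℕ) :
    ultraSet ω (partialUnion A (l + 1)) = ultraSet ω (partialUnion A l) ∪ ultraSet ω (A l) :=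
  ultraSet_union (partialUnion A l) (A l)

theorem Approx.compl {B : Set ((ω : Filter ℕ).Product Y)} {A : ∀ i, Set (Y i)}
    (h : Approx ω B A) : Approx ω Bᶜ (fun i => (A i)ᶜ) := by
  unfold Approx
  rw [ultraSet_compl, compl_symmDiff_compl]
  exact h

theorem ultraSet_partialUnion (A : ℕ → ∀ i, Set (Y i)) (l : ℕ) :
    ultraSet ω (partialUnion A l) = ⋃ j < l, ultraSet ω (A j) := by
  induction l with
  | zero => simpa [partialUnion] using ultraSet_empty (ω := ω) (Y := Y)
  | succ n ih => rw [ultraSet_partialUnion_succ, ih, Set.biUnion_lt_succ]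

variable [∀ i, Finite (Y i)] [∀ i, Nonempty (Y i)]

theorem tendsto_ultraDensity (A : ∀ i, Set (Y i)) :
    Tendsto (fun i => density (A i)) (ω : Filter ℕ) (𝓝 (ultraDensity ω A)) := by
  obtain ⟨x, -, hx⟩ := (isCompact_Icc (a := (0 : ℝ)) (b := 1)).ultrafilter_le_nhds
    (ω.map fun i => density (A i)) (by
      rw [le_principal_iff]
      exact Filter.mem_map.2 (Filter.univ_mem' fun i =>
        ⟨density_nonneg (A i), density_le_one (A i)⟩))
  exact tendsto_nhds_limUnder ⟨x, hx⟩

theorem ultraDensity_eq {A : ∀ i, Set (Y i)} {x : ℝ}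
    (h : Tendsto (fun i => density (A i)) (ω : Filter ℕ) (𝓝 x)) : ultraDensity ω A = x :=
  tendsto_nhds_unique (tendsto_ultraDensity A) h

theorem ultraDensity_nonneg (A : ∀ i, Set (Y i)) : 0 ≤ ultraDensity ω A :=
  ge_of_tendsto' (tendsto_ultraDensity A) fun _ => density_nonneg _

theorem ultraDensity_le_one (A : ∀ i, Set (Y i)) : ultraDensity ω A ≤ 1 :=
  le_of_tendsto' (tendsto_ultraDensity A) fun _ => density_le_one _

theorem ultraDensity_empty : ultraDensity ω (fun i => (∅ : Set (Y i))) = 0 :=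
  ultraDensity_eq (by simp [density_empty])

theorem ultraDensity_univ : ultraDensity ω (fun i => (Set.univ : Set (Y i))) = 1 :=
  ultraDensity_eq (by simp [density_univ])

theorem ultraDensity_mono {A B : ∀ i, Set (Y i)} (h : ultraSet ω A ⊆ ultraSet ω B) :
    ultraDensity ω A ≤ ultraDensity ω B :=
  le_of_tendsto_of_tendsto (tendsto_ultraDensity A) (tendsto_ultraDensity B)
    (by filter_upwards [ultraSet_subset_iff.1 h] with i hi using density_mono hi)

theorem ultraDensity_union_add_inter (A B : ∀ i, Set (Y i)) :
    ultraDensity ω (fun i => A i ∪ B i) + ultraDensity ω (fun i => A i ∩ B i) =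
      ultraDensity ω A + ultraDensity ω B := by
  refine tendsto_nhds_unique
    ((tendsto_ultraDensity fun i => A i ∪ B i).add (tendsto_ultraDensity fun i => A i ∩ B i)) ?_
  simp only [density_union_add_inter]
  exact (tendsto_ultraDensity A).add (tendsto_ultraDensity B)

theorem ultraDensity_union_le (A B : ∀ i, Set (Y i)) :
    ultraDensity ω (fun i => A i ∪ B i) ≤ ultraDensity ω A + ultraDensity ω B := by
  have h1 := ultraDensity_union_add_inter (ω := ω) A B
  have h2 := ultraDensity_nonneg (ω := ω) (fun i => A i ∩ B i)
  linarith

/-- An increasing sequence of ultraproduct sets has an ultraproduct upper bound whose measure is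
the limit of the measures. -/
theorem exists_ultraSet_bound (B : ℕ → ∀ i, Set (Y i)) (hB : ∀ i, Monotone fun l => B l i) {t : ℝ}
    (ht : Tendsto (fun l => ultraDensity ω (B l)) atTop (𝓝 t)) :
    ∃ C : ∀ i, Set (Y i), (∀ l, ultraSet ω (B l) ⊆ ultraSet ω C) ∧ ultraDensity ω C = t := by
  let G : ℕ → Set ℕ := fun i =>
    {m | ∀ l ≤ m, |density (B l i) - ultraDensity ω (B l)| ≤ 1 / ((l : ℝ) + 1)}
  have hG : ∀ m, ∀ᶠ i in (ω : Filter ℕ), m ∈ G i := by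
    intro m
    have : ∀ᶠ i in (ω : Filter ℕ), ∀ l ∈ Set.Iic m,
        |density (B l i) - ultraDensity ω (B l)| ≤ 1 / ((l : ℝ) + 1) := by
      rw [Filter.eventually_all_finite (Set.finite_Iic m)]
      intro l _
      have hp : (0 : ℝ) < 1 / ((l : ℝ) + 1) := by positivity
      filter_upwards [Metric.tendsto_nhds.1 (tendsto_ultraDensity (ω := ω) (B l)) _ hp] with i hi
      rw [Real.dist_eq] at hi
      exact hi.le
    exact this
  refine ⟨fun i => ⋃ m ∈ G i, B m i, ?_, ?_⟩
  · intro l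
    rw [ultraSet_subset_iff]
    filter_upwards [hG l] with i hi
    exact Set.subset_biUnion_of_mem (u := fun m => B m i) hi
  · apply ultraDensity_eq
    rw [Metric.tendsto_nhds]
    intro ε hε
    have h1 : Tendsto (fun M : ℕ => 1 / ((M : ℝ) + 1) + |ultraDensity ω (B M) - t|) atTop
        (𝓝 0) := by
      have h2 : Tendsto (fun M : ℕ => |ultraDensity ω (B M) - t|) atTop (𝓝 0) := by
        have := (ht.sub_const t).abs
        simpa using this
      simpa using tendsto_one_div_add_atTop_nhds_zero_nat.add h2
    obtain ⟨N, hN⟩ := eventually_atTop.1 ((tendsto_order.1 h1).2 ε hε)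
    filter_upwards [hG N] with i hi
    obtain ⟨M, hM, hNM, hC⟩ : ∃ M ∈ G i, N ≤ M ∧ (⋃ m ∈ G i, B m i) = B M i := by
      have hfin : ((fun m => B m i) '' G i).Finite := Set.toFinite _
      have hne : ((fun m => B m i) '' G i).Nonempty := ⟨_, N, hi, rfl⟩
      obtain ⟨T, ⟨⟨M, hM, rfl⟩, hmax⟩⟩ := hfin.exists_maximal hne
      have hmem : max N M ∈ G i := by
        rcases le_total N M with h | h
        · rwa [max_eq_right h]
        · rwa [max_eq_left h]
      refine ⟨max N M, hmem, le_max_left _ _, ?_⟩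
      apply Set.Subset.antisymm
      · refine Set.iUnion₂_subset fun m hm => ?_
        rcases le_total m M with h | h
        · exact hB i (h.trans (le_max_right _ _))
        · exact (hmax ⟨m, hm, rfl⟩ (hB i h)).trans (hB i (le_max_right _ _))
      · exact Set.subset_biUnion_of_mem (u := fun m => B m i) hmem
    rw [hC, Real.dist_eq]
    calc |density (B M i) - t|
        ≤ |density (B M i) - ultraDensity ω (B M)| + |ultraDensity ω (B M) - t| :=
          abs_sub_le _ _ _
      _ ≤ 1 / ((M : ℝ) + 1) + |ultraDensity ω (B M) - t| := by
          gcongr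
          exact hM M le_rfl
      _ < ε := hN M hNM

theorem isNullset_empty : IsNullset ω (∅ : Set ((ω : Filter ℕ).Product Y)) := by
  intro ε hε
  exact ⟨fun _ => ∅, Set.empty_subset _, by rw [ultraDensity_empty]; exact hε.le⟩

theorem IsNullset.ultraDensity_eq_zero {A : ∀ i, Set (Y i)} (h : IsNullset ω (ultraSet ω A)) :
    ultraDensity ω A = 0 := by
  refine le_antisymm (le_of_forall_pos_le_add fun ε hε => ?_) (ultraDensity_nonneg A)
  obtain ⟨B, hB, hB'⟩ := h ε hε
  rw [zero_add]
  exact (ultraDensity_mono hB).trans hB'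

theorem tendsto_partialUnion (A : ℕ → ∀ i, Set (Y i)) :
    Tendsto (fun l => ultraDensity ω (partialUnion A l)) atTop
      (𝓝 (⨆ l, ultraDensity ω (partialUnion A l))) := by
  refine tendsto_atTop_ciSup (monotone_nat_of_le_succ fun l => ultraDensity_mono ?_) ?_
  · rw [ultraSet_partialUnion_succ]
    exact Set.subset_union_left
  · refine ⟨1, ?_⟩
    rintro _ ⟨l, rfl⟩
    exact ultraDensity_le_one _

theorem IsNullset.iUnion {N : ℕ → Set ((ω : Filter ℕ).Product Y)} (h : ∀ j, IsNullset ω (N j)) :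
    IsNullset ω (⋃ j, N j) := by
  intro ε hε
  choose A hA hA' using fun j => h j (ε / 2 / 2 ^ j) (by positivity)
  obtain ⟨C, hC, hC'⟩ := exists_ultraSet_bound (ω := ω) (partialUnion A) (partialUnion_mono A)
    (tendsto_partialUnion A)
  refine ⟨C, Set.iUnion_subset fun j => (hA j).trans (Set.Subset.trans ?_ (hC (j + 1))), ?_⟩
  · rw [ultraSet_partialUnion_succ]
    exact Set.subset_union_right
  · rw [hC']
    refine ciSup_le fun l => ?_
    have : ultraDensity ω (partialUnion A l) ≤ ∑ j ∈ Finset.range l, ε / 2 / 2 ^ j := by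
      induction l with
      | zero => simpa [partialUnion] using (ultraDensity_empty (ω := ω) (Y := Y)).le
      | succ n ih =>
        rw [Finset.sum_range_succ]
        exact (ultraDensity_union_le (partialUnion A n) (A n)).trans (add_le_add ih (hA' n))
    refine this.trans ?_
    have h2 := (summable_geometric_two' ε).sum_le_tsum (Finset.range l)
      (fun j _ => by positivity)
    rwa [tsum_geometric_two'] at h2

theorem IsNullset.union {N M : Set ((ω : Filter ℕ).Product Y)} (hN : IsNullset ω N)
    (hM : IsNullset ω M) : IsNullset ω (N ∪ M) := by
  have h := IsNullset.iUnion (ω := ω) (N := fun j : ℕ => if j = 0 then N else M)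
    (fun j => by split_ifs <;> assumption)
  refine h.subset (Set.union_subset ?_ ?_)
  · exact Set.subset_iUnion_of_subset 0 (by simp)
  · exact Set.subset_iUnion_of_subset 1 (by simp)

theorem approx_self (A : ∀ i, Set (Y i)) : Approx ω (ultraSet ω A) A := by
  unfold Approx
  rw [symmDiff_self]
  exact isNullset_empty

/-- Comparison of the two approximations of nested sets. -/
theorem Approx.ultraDensity_le {B B' : Set ((ω : Filter ℕ).Product Y)} {A A' : ∀ i, Set (Y i)}
    (h : Approx ω B A) (h' : Approx ω B' A') (hBB : B ⊆ B') :
    ultraDensity ω A ≤ ultraDensity ω A' := by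
  have h1 : IsNullset ω (ultraSet ω fun i => A i ∩ (A' i)ᶜ) := by
    refine (IsNullset.union h h').subset ?_
    rw [ultraSet_inter A fun i => (A' i)ᶜ, ultraSet_compl]
    rintro q ⟨hq, hq'⟩
    by_cases hB : q ∈ B'
    · exact Or.inr (Or.inl ⟨hB, hq'⟩)
    · exact Or.inl (Or.inr ⟨hq, fun hb => hB (hBB hb)⟩)
  have h2 : ultraDensity ω A ≤ ultraDensity ω (fun i => A' i ∪ (A i ∩ (A' i)ᶜ)) := by
    refine ultraDensity_mono (ultraSet_subset_iff.2 (Eventually.of_forall fun i x hx => ?_))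
    by_cases hx' : x ∈ A' i
    · exact Or.inl hx'
    · exact Or.inr ⟨hx, hx'⟩
  have h3 := ultraDensity_union_le (ω := ω) A' (fun i => A i ∩ (A' i)ᶜ)
  have h4 := h1.ultraDensity_eq_zero
  linarith

theorem Approx.ultraDensity_eq {B : Set ((ω : Filter ℕ).Product Y)} {A A' : ∀ i, Set (Y i)}
    (h : Approx ω B A) (h' : Approx ω B A') : ultraDensity ω A = ultraDensity ω A' :=
  le_antisymm (h.ultraDensity_le h' subset_rfl) (h'.ultraDensity_le h subset_rfl)

theorem Approx.iUnion {B : ℕ → Set ((ω : Filter ℕ).Product Y)} {A : ℕ → ∀ i, Set (Y i)}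
    (h : ∀ j, Approx ω (B j) (A j)) :
    ∃ C : ∀ i, Set (Y i), Approx ω (⋃ j, B j) C ∧
      Tendsto (fun l => ultraDensity ω (partialUnion A l)) atTop (𝓝 (ultraDensity ω C)) := by
  obtain ⟨C, hC, hC'⟩ := exists_ultraSet_bound (ω := ω) (partialUnion A) (partialUnion_mono A)
    (tendsto_partialUnion A)
  have hlim := tendsto_partialUnion (ω := ω) A
  rw [← hC'] at hlim
  refine ⟨C, ?_, hlim⟩
  have hnull : IsNullset ω (ultraSet ω C \ ⋃ j, ultraSet ω (A j)) := by
    intro ε hε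
    obtain ⟨l, hl⟩ := ((tendsto_order.1 hlim).1 (ultraDensity ω C - ε) (by linarith)).exists
    refine ⟨fun i => C i ∩ (partialUnion A l i)ᶜ, ?_, ?_⟩
    · rw [ultraSet_inter C fun i => (partialUnion A l i)ᶜ, ultraSet_compl, ultraSet_partialUnion]
      rintro q ⟨hq, hq'⟩
      refine ⟨hq, fun hc => hq' ?_⟩
      obtain ⟨j, -, hj⟩ := Set.mem_iUnion₂.1 hc
      exact Set.mem_iUnion.2 ⟨j, hj⟩
    · have h1 := ultraDensity_union_add_inter (ω := ω) (partialUnion A l)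
        (fun i => C i ∩ (partialUnion A l i)ᶜ)
      have h2 : ultraDensity ω (fun i => partialUnion A l i ∩ (C i ∩ (partialUnion A l i)ᶜ)) = 0 := by
        have : (fun i => partialUnion A l i ∩ (C i ∩ (partialUnion A l i)ᶜ)) =
            fun i => (∅ : Set (Y i)) := by
          funext i
          ext x
          simp only [Set.mem_inter_iff, Set.mem_compl_iff, Set.mem_empty_iff_false]
          tauto
        rw [this, ultraDensity_empty]
      have h3 : ultraDensity ω (fun i => partialUnion A l i ∪ (C i ∩ (partialUnion A l i)ᶜ)) ≤
          ultraDensity ω C := by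
        refine ultraDensity_mono ?_
        rw [ultraSet_union, ultraSet_inter C fun i => (partialUnion A l i)ᶜ]
        exact Set.union_subset (hC l) Set.inter_subset_left
      linarith
  refine ((IsNullset.iUnion h).union hnull).subset ?_
  rintro q (⟨hq, hq'⟩ | ⟨hq, hq'⟩)
  · obtain ⟨j, hj⟩ := Set.mem_iUnion.1 hq
    refine Or.inl (Set.mem_iUnion.2 ⟨j, Or.inl ⟨hj, fun hc => hq' (hC (j + 1) ?_)⟩⟩)
    rw [ultraSet_partialUnion_succ]
    exact Or.inr hc
  · by_cases hA : q ∈ ⋃ j, ultraSet ω (A j)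
    · obtain ⟨j, hj⟩ := Set.mem_iUnion.1 hA
      exact Or.inl (Set.mem_iUnion.2 ⟨j, Or.inr ⟨hj, fun hc => hq' (Set.mem_iUnion.2 ⟨j, hc⟩)⟩⟩)
    · exact Or.inr ⟨hq, hA⟩

variable (ω Y) in
/-- The measurable sets of the ultraproduct of the finite sets `Y_i`. -/
instance ultraMeasurableSpace : MeasurableSpace ((ω : Filter ℕ).Product Y) where
  MeasurableSet' := IsMeas ω
  measurableSet_empty := ⟨fun _ => ∅, by
    have := approx_self (ω := ω) (fun i => (∅ : Set (Y i)))
    rwa [ultraSet_empty] at this⟩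
  measurableSet_compl := fun _ ⟨_, hA⟩ => ⟨_, hA.compl⟩
  measurableSet_iUnion := fun _ h => by
    choose A hA using h
    obtain ⟨C, hC, -⟩ := Approx.iUnion hA
    exact ⟨C, hC⟩

/-- The measure of a measurable set `B`: the measure of an ultraproduct set which agrees with `B`
up to a nullset. -/
def measVal (B : Set ((ω : Filter ℕ).Product Y)) (hB : MeasurableSet B) : ENNReal :=
  ENNReal.ofReal (ultraDensity ω (Classical.choose (show IsMeas ω B from hB)))

theorem measVal_eq {B : Set ((ω : Filter ℕ).Product Y)} (hB : MeasurableSet B)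
    {A : ∀ i, Set (Y i)} (h : Approx ω B A) :
    measVal B hB = ENNReal.ofReal (ultraDensity ω A) := by
  unfold measVal
  rw [(Classical.choose_spec (show IsMeas ω B from hB)).ultraDensity_eq h]

theorem measVal_iUnion (B : ℕ → Set ((ω : Filter ℕ).Product Y)) (hB : ∀ j, MeasurableSet (B j))
    (hd : Pairwise (Function.onFun Disjoint B)) :
    measVal (⋃ j, B j) (MeasurableSet.iUnion hB) = ∑' j, measVal (B j) (hB j) := by
  choose A hA using fun j => (show IsMeas ω (B j) from hB j)
  obtain ⟨C, hC, hlim⟩ := Approx.iUnion hA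
  rw [measVal_eq _ hC]
  simp only [fun j => measVal_eq (hB j) (hA j)]
  have hsum : ∀ l, ultraDensity ω (partialUnion A l) =
      ∑ j ∈ Finset.range l, ultraDensity ω (A j) := by
    intro l
    induction l with
    | zero => simpa [partialUnion] using ultraDensity_empty (ω := ω) (Y := Y)
    | succ n ih =>
      rw [Finset.sum_range_succ, ← ih]
      have h1 := ultraDensity_union_add_inter (ω := ω) (partialUnion A n) (A n)
      have h2 : IsNullset ω (ultraSet ω fun i => partialUnion A n i ∩ A n i) := by
        refine (IsNullset.iUnion hA).subset ?_
        rw [ultraSet_inter (partialUnion A n) (A n), ultraSet_partialUnion]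
        rintro q ⟨hq, hq'⟩
        obtain ⟨j, hj, hqj⟩ := Set.mem_iUnion₂.1 hq
        by_cases hqB : q ∈ B n
        · exact Set.mem_iUnion.2 ⟨j, Or.inr ⟨hqj, fun hc =>
            Set.disjoint_left.1 (hd (ne_of_lt hj)) hc hqB⟩⟩
        · exact Set.mem_iUnion.2 ⟨n, Or.inr ⟨hq', hqB⟩⟩
      have h3 := h2.ultraDensity_eq_zero
      have h4 : ultraDensity ω (partialUnion A (n + 1)) =
        ultraDensity ω (fun i => partialUnion A n i ∪ A n i) := rfl
      linarith
  have hs : HasSum (fun j => ultraDensity ω (A j)) (ultraDensity ω C) := by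
    rw [hasSum_iff_tendsto_nat_of_nonneg fun j => ultraDensity_nonneg (A j)]
    simpa only [hsum] using hlim
  rw [← hs.tsum_eq, ENNReal.ofReal_tsum_of_nonneg (fun j => ultraDensity_nonneg (A j)) hs.summable]

variable (ω Y) in
/-- The probability measure on the ultraproduct of the finite sets `Y_i`. -/
def ultraMeasure : Measure ((ω : Filter ℕ).Product Y) :=
  Measure.ofMeasurable measVal
    (by
      have h := approx_self (ω := ω) (fun i => (∅ : Set (Y i)))
      rw [ultraSet_empty] at h
      rw [measVal_eq _ h, ultraDensity_empty, ENNReal.ofReal_zero])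
    (fun B hB hd => measVal_iUnion B hB hd)

theorem ultraMeasure_apply {B : Set ((ω : Filter ℕ).Product Y)} {A : ∀ i, Set (Y i)}
    (h : Approx ω B A) : ultraMeasure ω Y B = ENNReal.ofReal (ultraDensity ω A) := by
  have hB : MeasurableSet B := ⟨A, h⟩
  unfold ultraMeasure
  rw [Measure.ofMeasurable_apply B hB, measVal_eq hB h]

instance : IsProbabilityMeasure (ultraMeasure ω Y) where
  measure_univ := by
    have h := approx_self (ω := ω) (fun i => (Set.univ : Set (Y i)))
    rw [ultraSet_univ] at h
    rw [ultraMeasure_apply h, ultraDensity_univ, ENNReal.ofReal_one]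

end ultra

section power
variable (ω : Ultrafilter ℕ) (X : ℕ → Type*) {k : ℕ}

/-- The space `𝐗^{[k]}`: the ultraproduct of the sets `X_i × ⋯ × X_i` (`k` factors). -/
abbrev UltraPow (k : ℕ) : Type _ := (ω : Filter ℕ).Product fun i => Fin k → X i

/-- The space `𝐗^A` for `A ⊆ [k]`: the ultraproduct of the sets `X_i^A`. -/
abbrev UltraPowOn (A : Finset (Fin k)) : Type _ := (ω : Filter ℕ).Product fun i => A → X i

/-- The projection `p_A : 𝐗^{[k]} → 𝐗^A`, which restricts every `k`-tuple to the coordinates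
in `A`. -/
def proj (A : Finset (Fin k)) : UltraPow ω X k → UltraPowOn ω X A :=
  Quotient.map (fun x i j => x i j) (fun p p' (h : ∀ᶠ i in (ω : Filter ℕ), p i = p' i) => by
    show ∀ᶠ i in (ω : Filter ℕ), (fun j : A => p i j) = fun j : A => p' i j
    filter_upwards [h] with i hi
    rw [hi])

variable [∀ i, Finite (X i)] [∀ i, Nonempty (X i)]

/-- `σ(A) = p_A⁻¹(𝓑_A)`, the measurable sets which depend only on the coordinates in `A`. -/
@[reducible] def sigma (A : Finset (Fin k)) : MeasurableSpace (UltraPow ω X k) :=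
  MeasurableSpace.comap (proj ω X A) inferInstance

/-- `σ(A)^*`, generated by all `σ(B)` with `B ⊆ A` and `|B| = |A| - 1` (for nonempty `A`). -/
@[reducible] def sigmaStar (A : Finset (Fin k)) : MeasurableSpace (UltraPow ω X k) :=
  ⨆ (B : Finset (Fin k)) (_ : B ⊆ A ∧ B.card + 1 = A.card), sigma ω X B

variable {ω X}

theorem density_preimage_restrict {Z : Type*} [Finite Z] [Nonempty Z] (A : Finset (Fin k))
    (T : Set (A → Z)) :
    density ((fun (x : Fin k → Z) (j : A) => x j) ⁻¹' T) = density T := by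
  let e : (Fin k → Z) ≃ (A → Z) × ({j // j ∉ A} → Z) := Equiv.piEquivPiSubtypeProd (· ∈ A) _
  have h : ((fun (x : Fin k → Z) (j : A) => x j) ⁻¹' T) = e ⁻¹' (T ×ˢ Set.univ) := by
    ext x
    simp only [Set.mem_preimage, Set.mem_prod, Set.mem_univ, and_true]
    rfl
  unfold density
  rw [h, Set.ncard_preimage_of_injective_subset_range e.injective (by simp), Set.ncard_prod,
    Nat.card_congr e, Nat.card_prod, Set.ncard_univ]
  push_cast
  have : (Nat.card ({j // j ∉ A} → Z) : ℝ) ≠ 0 := by exact_mod_cast Nat.card_pos.ne'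
  exact mul_div_mul_right _ _ this

/-- Every `σ(A)` consists of measurable sets of `𝐗^{[k]}`. -/
theorem sigma_le (A : Finset (Fin k)) : sigma ω X A ≤ ultraMeasurableSpace ω _ := by
  have key : ∀ T : ∀ i, Set (A → X i), proj ω X A ⁻¹' ultraSet ω T =
      ultraSet ω fun i => (fun (x : Fin k → X i) (j : A) => x j) ⁻¹' T i := by
    intro T
    ext q
    induction q using mk_ind with
    | h p => exact Iff.rfl
  rintro _ ⟨B, ⟨T, hT⟩, rfl⟩
  refine ⟨fun i => (fun (x : Fin k → X i) (j : A) => x j) ⁻¹' T i, ?_⟩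
  unfold Approx
  rw [← key, ← Set.preimage_symmDiff]
  intro ε hε
  obtain ⟨C, hC, hC'⟩ := hT ε hε
  refine ⟨fun i => (fun (x : Fin k → X i) (j : A) => x j) ⁻¹' C i, ?_, ?_⟩
  · rw [← key]
    exact Set.preimage_mono hC
  · unfold ultraDensity at hC' ⊢
    simpa only [density_preimage_restrict] using hC'

theorem sigmaStar_le (A : Finset (Fin k)) : sigmaStar ω X A ≤ ultraMeasurableSpace ω _ :=
  iSup₂_le fun B _ => sigma_le B

end power

end

end UltraLoeb

/-! Constancy of `E(S | σ(A)^*)` says that `μ(S ∩ U) = c * μ(U)` for every `U ∈ σ(A)^*`. The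
remaining sets need not lie in `σ(A)^*`, but their sections do: if `A ⊄ B` and the coordinates
outside `A` are frozen, a cylinder over `B` becomes a cylinder over `A ∩ B`, a proper subset of `A`.

No Fubini theorem on the ultraproduct is needed. In each finite power `X_i^k`, a linear combination
`a * density (S ∩ T) + b * density T` is an average over the frozen values `z` of the same
combination for the sections of `T`, provided `S` depends only on `A`. Hence some `z` does at least
as well as the average (`exists_density_section`). In the ultralimit the chosen sections form a set
of `σ(A)^*`, where the combination vanishes if `a * c + b = 0`. Both signs of `(1, -c)` together
give `μ(S ∩ T) = c * μ(T)` (`ultraDensity_inter_eq_mul`).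

The theorem follows by induction on the number of sets, splitting off one with `|A|` maximal; by
distinctness this `A` is contained in none of the other index sets. -/

namespace UltraLoeb

/-! ### Averaging over sections in a finite power -/

section section_averaging

theorem density_eq_sum {Z : Type*} [Fintype Z] (P : Set Z) :
    density P = (∑ x, P.indicator (fun _ => (1 : ℝ)) x) / Fintype.card Z := by
  classical
  unfold density
  rw [Nat.card_eq_fintype_card, Set.ncard_eq_toFinset_card', ← Set.filter_mem_univ_eq_toFinset]
  simp only [Set.indicator_apply, Finset.sum_boole]

/-- Exchanging the coordinates outside `A` between two points. -/
def exchange {ι Z : Type*} [DecidableEq ι] (A : Finset ι) :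
    ((ι → Z) × (ι → Z)) ≃ ((ι → Z) × (ι → Z)) :=
  Function.Involutive.toPerm (fun p => (A.piecewise p.1 p.2, A.piecewise p.2 p.1)) fun p => by
    ext j <;> by_cases hj : j ∈ A <;> simp [hj]

theorem exists_sum_le_sum_piecewise {ι Z : Type*} [DecidableEq ι] [Fintype ι] [Fintype Z]
    [Nonempty Z] (A : Finset ι) (F : (ι → Z) → ℝ) :
    ∃ z : ι → Z, ∑ x, F x ≤ ∑ x, F (A.piecewise x z) := by
  -- Both sides are sums over pairs `(x, z)`, and `exchange A` permutes the pairs, with first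
  -- component `A.piecewise x z`.
  have h : ∑ _z : ι → Z, ∑ x, F x = ∑ z, ∑ x, F (A.piecewise x z) := by
    rw [Finset.sum_comm, ← Fintype.sum_prod_type' (fun x _ => F x), Finset.sum_comm,
      ← Fintype.sum_prod_type' (fun x z => F (A.piecewise x z)),
      ← Equiv.sum_comp (exchange A) (fun p => F p.1)]
    rfl
  obtain ⟨z, -, hz⟩ := Finset.exists_le_of_sum_le Finset.univ_nonempty h.le
  exact ⟨z, hz⟩

/-- Some section of `T` along the coordinates in `A` does at least as well as `T` itself for a
linear combination of the densities of `S ∩ T` and `T`, where `S` depends only on `A`. -/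
theorem exists_density_section {ι Z : Type*} [DecidableEq ι] [Finite ι] [Finite Z]
    [Nonempty Z] (A : Finset ι) {S : Set (ι → Z)} (hS : DependsOn (· ∈ S) (A : Set ι))
    (T : Set (ι → Z)) (a b : ℝ) :
    ∃ z : ι → Z, a * density (S ∩ T) + b * density T ≤
      a * density (S ∩ (fun x => A.piecewise x z) ⁻¹' T) +
        b * density ((fun x => A.piecewise x z) ⁻¹' T) := by
  classical
  have := Fintype.ofFinite ι
  have := Fintype.ofFinite Z
  obtain ⟨z, hz⟩ := exists_sum_le_sum_piecewise A fun x : ι → Z =>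
    a * (S ∩ T).indicator (fun _ => (1 : ℝ)) x + b * T.indicator (fun _ => (1 : ℝ)) x
  refine ⟨z, ?_⟩
  have hST : ∀ x, (S ∩ T).indicator (fun _ => (1 : ℝ)) (A.piecewise x z) =
      (S ∩ (fun x => A.piecewise x z) ⁻¹' T).indicator (fun _ => (1 : ℝ)) x := by
    intro x
    -- Freezing coordinates outside `A` does not affect `S`, so only `T` is replaced by its section.
    have h : (A.piecewise x z ∈ S) = (x ∈ S) := hS fun j hj => by
      simp [Finset.mem_coe.1 hj]
    simp only [Set.indicator_apply, Set.mem_inter_iff, Set.mem_preimage, h]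
  have hT : ∀ x, T.indicator (fun _ => (1 : ℝ)) (A.piecewise x z) =
      ((fun x => A.piecewise x z) ⁻¹' T).indicator (fun _ => (1 : ℝ)) x := fun x => rfl
  simp only [hST, hT, Finset.sum_add_distrib, ← Finset.mul_sum] at hz
  simp only [density_eq_sum, ← mul_div_assoc, ← add_div]
  gcongr

/-- Outside `A` the values come from `z`, so only coordinates in `A ∩ B` still matter. The section
is kept as a subset of the full power, so that one ambient measure suffices. -/
theorem dependsOn_preimage_piecewise {ι Z : Type*} [DecidableEq ι] {A B C : Finset ι}
    {T : Set (ι → Z)} (hT : DependsOn (· ∈ T) (B : Set ι)) (hABC : A ∩ B ⊆ C) (z : ι → Z) :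
    DependsOn (· ∈ (fun x => A.piecewise x z) ⁻¹' T) (C : Set ι) := by
  intro x y hxy
  refine hT fun j hj => ?_
  by_cases hA : j ∈ A
  · simpa [hA] using hxy j (hABC (Finset.mem_inter.2 ⟨hA, hj⟩))
  · simp [hA]

end section_averaging

/-! ### Ultraproduct sets and null sets under the measure -/

section measure
variable {ω : Ultrafilter ℕ} {Y : ℕ → Type*}

theorem ultraSet_biInter {κ : Type*} (s : Finset κ) (P : κ → ∀ i, Set (Y i)) :
    ultraSet ω (fun i => ⋂ j ∈ s, P j i) = ⋂ j ∈ s, ultraSet ω (P j) := by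
  ext q
  induction q using mk_ind with
  | h p =>
    simp only [mk_mem_ultraSet, Set.mem_iInter]
    exact Filter.eventually_all_finset s

variable [∀ i, Finite (Y i)] [∀ i, Nonempty (Y i)]

theorem measurableSet_ultraSet (A : ∀ i, Set (Y i)) : MeasurableSet (ultraSet ω A) :=
  ⟨A, approx_self A⟩

theorem ultraMeasure_real_ultraSet (A : ∀ i, Set (Y i)) :
    (ultraMeasure ω Y).real (ultraSet ω A) = ultraDensity ω A := by
  rw [Measure.real, ultraMeasure_apply (approx_self A),
    ENNReal.toReal_ofReal (ultraDensity_nonneg A)]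

theorem IsNullset.measure_eq_zero {N : Set ((ω : Filter ℕ).Product Y)} (h : IsNullset ω N) :
    ultraMeasure ω Y N = 0 := by
  have hN : Approx ω N fun i => (∅ : Set (Y i)) := by
    unfold Approx
    rwa [ultraSet_empty, ← Set.bot_eq_empty, symmDiff_bot]
  rw [ultraMeasure_apply hN, ultraDensity_empty, ENNReal.ofReal_zero]

theorem Approx.ae_eq {B : Set ((ω : Filter ℕ).Product Y)} {A : ∀ i, Set (Y i)}
    (h : Approx ω B A) : B =ᵐ[ultraMeasure ω Y] ultraSet ω A :=
  measure_symmDiff_eq_zero_iff.1 (IsNullset.measure_eq_zero h)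

end measure

/-! ### Cylinders, their sections, and independence -/

section cylinder
variable {ω : Ultrafilter ℕ} {X : ℕ → Type*} {k : ℕ}

theorem preimage_proj_ultraSet (A : Finset (Fin k)) (T : ∀ i, Set (A → X i)) :
    proj ω X A ⁻¹' ultraSet ω T =
      ultraSet ω fun i => (fun (x : Fin k → X i) (j : A) => x j) ⁻¹' T i := by
  ext q
  induction q using mk_ind with
  | h p => exact Iff.rfl

variable [∀ i, Finite (X i)] [∀ i, Nonempty (X i)]

theorem measurableSet_sigma_ultraSet {A : Finset (Fin k)} {P : ∀ i, Set (Fin k → X i)}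
    (hP : ∀ i, DependsOn (· ∈ P i) (A : Set (Fin k))) :
    MeasurableSet[sigma ω X A] (ultraSet ω P) := by
  -- A set depending only on `A` is saturated for the restriction map: it is the preimage of its
  -- image.
  refine ⟨ultraSet ω fun i => (fun (x : Fin k → X i) (j : A) => x j) '' P i,
    measurableSet_ultraSet _, ?_⟩
  rw [preimage_proj_ultraSet]
  congr 1
  funext i
  refine Set.Subset.antisymm ?_ (Set.subset_preimage_image _ _)
  rintro x ⟨y, hy, hxy⟩
  exact ((hP i : DependsOn (· ∈ P i) (A : Set (Fin k)))
    fun j hj => congrFun hxy ⟨j, hj⟩).mp hy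

/-- The approximation is made in `𝐗^A` and then pulled back. This yields genuine cylinders at every
`i`, and pulling back preserves densities, hence nullsets. -/
theorem exists_approx_of_measurableSet_sigma {A : Finset (Fin k)} {S : Set (UltraPow ω X k)}
    (hS : MeasurableSet[sigma ω X A] S) :
    ∃ P : ∀ i, Set (Fin k → X i), (∀ i, DependsOn (· ∈ P i) (A : Set (Fin k))) ∧
      Approx ω S P := by
  obtain ⟨B, ⟨T, hT⟩, rfl⟩ := hS
  refine ⟨fun i => (fun (x : Fin k → X i) (j : A) => x j) ⁻¹' T i, fun i x y hxy => ?_, ?_⟩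
  · have : (fun j : A => x j) = fun j : A => y j := funext fun j => hxy j j.2
    simp only [Set.mem_preimage, this]
  · unfold Approx
    rw [← preimage_proj_ultraSet, ← Set.preimage_symmDiff]
    intro ε hε
    obtain ⟨C, hC, hC'⟩ := hT ε hε
    refine ⟨fun i => (fun (x : Fin k → X i) (j : A) => x j) ⁻¹' C i, ?_, ?_⟩
    · rw [← preimage_proj_ultraSet]
      exact Set.preimage_mono hC
    · unfold ultraDensity at hC' ⊢
      simpa only [density_preimage_restrict] using hC'

/-- With `e ∈ A \ B`, the section depends only on `A ∩ B ⊆ A.erase e`, and `σ(A.erase e)` is one of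
the generators of `σ(A)^*`. -/
theorem measurableSet_sigmaStar_ultraSet {A B : Finset (Fin k)} (hAB : ¬ A ⊆ B)
    {T : ∀ i, Set (Fin k → X i)} (hT : ∀ i, DependsOn (· ∈ T i) (B : Set (Fin k)))
    (z : ∀ i, Fin k → X i) :
    MeasurableSet[sigmaStar ω X A]
      (ultraSet ω fun i => (fun x => A.piecewise x (z i)) ⁻¹' T i) := by
  obtain ⟨e, heA, heB⟩ := Finset.not_subset.1 hAB
  have hle : sigma ω X (A.erase e) ≤ sigmaStar ω X A :=
    le_iSup₂_of_le (A.erase e) ⟨Finset.erase_subset _ _, Finset.card_erase_add_one heA⟩ le_rfl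
  refine hle _ (measurableSet_sigma_ultraSet fun i => ?_)
  refine dependsOn_preimage_piecewise (hT i) (fun j hj => ?_) (z i)
  rw [Finset.mem_inter] at hj
  exact Finset.mem_erase.2 ⟨fun h => heB (h ▸ hj.2), hj.1⟩

/-- A cylinder over `A` which has density `c` in every set of `σ(A)^*` has density `c` in every
finite intersection of cylinders over sets which do not contain `A`. -/
theorem ultraDensity_inter_eq_mul {κ : Type*} {A : Finset (Fin k)}
    {S : ∀ i, Set (Fin k → X i)} (hS : ∀ i, DependsOn (· ∈ S i) (A : Set (Fin k))) {c : ℝ}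
    (hc : ∀ U, MeasurableSet[sigmaStar ω X A] U →
      (ultraMeasure ω fun i => Fin k → X i).real (ultraSet ω S ∩ U) =
        c * (ultraMeasure ω fun i => Fin k → X i).real U)
    (s : Finset κ) {B : κ → Finset (Fin k)} (hB : ∀ j ∈ s, ¬ A ⊆ B j)
    {T : κ → ∀ i, Set (Fin k → X i)}
    (hT : ∀ j i, DependsOn (· ∈ T j i) (B j : Set (Fin k))) :
    ultraDensity ω (fun i => S i ∩ ⋂ j ∈ s, T j i) =
      c * ultraDensity ω (fun i => ⋂ j ∈ s, T j i) := by
  have key : ∀ a b : ℝ, a * c + b = 0 →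
      a * ultraDensity ω (fun i => S i ∩ ⋂ j ∈ s, T j i) +
        b * ultraDensity ω (fun i => ⋂ j ∈ s, T j i) ≤ 0 := by
    intro a b hab
    -- The frozen point `z i` varies with `i` and with the pair `(a, b)`; the inequality survives
    -- the ultralimit.
    choose z hz using fun i => exists_density_section A (hS i) (⋂ j ∈ s, T j i) a b
    have hlim := le_of_tendsto_of_tendsto'
      (((tendsto_ultraDensity (ω := ω) _).const_mul a).add
        ((tendsto_ultraDensity (ω := ω) _).const_mul b))
      (((tendsto_ultraDensity (ω := ω) _).const_mul a).add
        ((tendsto_ultraDensity (ω := ω) _).const_mul b)) hz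
    refine hlim.trans_eq ?_
    have hU : MeasurableSet[sigmaStar ω X A]
        (ultraSet ω fun i => (fun x => A.piecewise x (z i)) ⁻¹' ⋂ j ∈ s, T j i) := by
      simp only [Set.preimage_iInter]
      rw [ultraSet_biInter s fun j i => (fun x => A.piecewise x (z i)) ⁻¹' T j i]
      exact Finset.measurableSet_biInter s fun j hj =>
        measurableSet_sigmaStar_ultraSet (hB j hj) (hT j) z
    have h := hc _ hU
    rw [← ultraSet_inter, ultraMeasure_real_ultraSet, ultraMeasure_real_ultraSet] at h
    rw [h, ← mul_assoc, ← add_mul, hab, zero_mul]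
  -- Opposite signs turn the one-sided bound into an equality.
  have h1 := key 1 (-c) (by ring)
  have h2 := key (-1) c (by ring)
  linarith

/-- Integrating the conditional expectation over `U` gives `μ(S ∩ U)`, and the integrand is almost
everywhere `c`. -/
theorem measureReal_inter_eq_mul {A : Finset (Fin k)} {S : Set (UltraPow ω X k)}
    (hS : MeasurableSet S) {c : ℝ}
    (hE : (ultraMeasure ω fun n => Fin k → X n)[S.indicator (fun _ => (1 : ℝ)) | sigmaStar ω X A]
      =ᵐ[ultraMeasure ω fun n => Fin k → X n] fun _ => c)
    {U : Set (UltraPow ω X k)} (hU : MeasurableSet[sigmaStar ω X A] U) :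
    (ultraMeasure ω fun n => Fin k → X n).real (S ∩ U) =
      c * (ultraMeasure ω fun n => Fin k → X n).real U := by
  have h := setIntegral_condExp (μ := ultraMeasure ω fun n => Fin k → X n) (sigmaStar_le A)
    ((integrable_const (1 : ℝ)).indicator hS) hU
  rw [integral_congr_ae (ae_restrict_of_ae hE), setIntegral_indicator hS] at h
  simp only [setIntegral_const, smul_eq_mul, mul_one] at h
  rw [Set.inter_comm, ← h, mul_comm]

theorem measureReal_biInter_eq_prod {κ : Type*} [DecidableEq κ] {A : κ → Finset (Fin k)}
    (hA : Function.Injective A) {S : κ → Set (UltraPow ω X k)}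
    (hS : ∀ i, MeasurableSet[sigma ω X (A i)] (S i))
    (hE : ∀ i, ∃ c : ℝ,
      (ultraMeasure ω fun n => Fin k → X n)[
        (S i).indicator (fun _ => (1 : ℝ)) | sigmaStar ω X (A i)]
        =ᵐ[ultraMeasure ω fun n => Fin k → X n] fun _ => c) (s : Finset κ) :
    (ultraMeasure ω fun n => Fin k → X n).real (⋂ i ∈ s, S i) =
      ∏ i ∈ s, (ultraMeasure ω fun n => Fin k → X n).real (S i) := by
  choose P hP hPS using fun i => exists_approx_of_measurableSet_sigma (hS i)
  have hS' : ∀ i, MeasurableSet (S i) := fun i => sigma_le (A i) _ (hS i)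
  -- The inserted index `a` has `|A a|` at least that of every index already in `s`.
  induction s using Finset.induction_on_max_value (fun i => (A i).card) with
  | empty => simp
  | insert a s has hmax ih =>
    obtain ⟨c, hc⟩ := hE a
    have hc' : ∀ U, MeasurableSet[sigmaStar ω X (A a)] U →
        (ultraMeasure ω fun i => Fin k → X i).real (S a ∩ U) =
          c * (ultraMeasure ω fun i => Fin k → X i).real U :=
      fun U hU => measureReal_inter_eq_mul (hS' a) hc hU
    -- Taking `U` to be the whole space identifies the constant `c`.
    have hSa : (ultraMeasure ω fun i => Fin k → X i).real (S a) = c := by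
      simpa using hc' Set.univ MeasurableSet.univ
    -- Inclusion together with `|A j| ≤ |A a|` would force `A a = A j`, against injectivity.
    have hsub : ∀ j ∈ s, ¬ A a ⊆ A j := fun j hj h =>
      has (hA (Finset.eq_of_subset_of_card_le h (hmax j hj)) ▸ hj)
    -- The averaging argument needs exact cylinders, so the property of `S a` is transferred to its
    -- approximation `P a`.
    have hinter := ultraDensity_inter_eq_mul (hP a) (c := c) (fun U hU => by
      rw [← hc' U hU]
      exact measureReal_congr ((hPS a).ae_eq.symm.inter (ae_eq_refl U))) s hsub hP
    have hs : (⋂ i ∈ s, S i : Set (UltraPow ω X k)) =ᵐ[ultraMeasure ω fun n => Fin k → X n]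
        ultraSet ω fun i => ⋂ j ∈ s, P j i := by
      rw [ultraSet_biInter]
      exact Finset.eventuallyEq_iInter s fun j _ => (hPS j).ae_eq
    rw [Finset.set_biInter_insert, Finset.prod_insert has, ← ih, hSa,
      measureReal_congr ((hPS a).ae_eq.inter hs), measureReal_congr hs, ← ultraSet_inter,
      ultraMeasure_real_ultraSet, ultraMeasure_real_ultraSet, hinter]

end cylinder

end UltraLoeb

theorem mainTheorem2 {X : ℕ → Type*} [∀ i, Finite (X i)] [∀ i, Nonempty (X i)]
    (hX : StrictMono fun i => Nat.card (X i))
    (ω : Ultrafilter ℕ) (hω : ∀ n : ℕ, ω ≠ pure n)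
    (k r : ℕ) (A : Fin r → Finset (Fin k)) (hA : Function.Injective A)
    (hA' : ∀ i, (A i).Nonempty)
    (S : Fin r → Set (UltraLoeb.UltraPow ω X k))
    (hS : ∀ i, MeasurableSet[UltraLoeb.sigma ω X (A i)] (S i))
    (hE : ∀ i, ∃ c : ℝ,
      (UltraLoeb.ultraMeasure ω fun n => Fin k → X n)[
        (S i).indicator (fun _ => (1 : ℝ)) | UltraLoeb.sigmaStar ω X (A i)]
        =ᵐ[UltraLoeb.ultraMeasure ω fun n => Fin k → X n] fun _ => c) :
    UltraLoeb.ultraMeasure ω (fun n => Fin k → X n) (⋂ i, S i) =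
      ∏ i, UltraLoeb.ultraMeasure ω (fun n => Fin k → X n) (S i) := by
  have h := UltraLoeb.measureReal_biInter_eq_prod hA hS hE Finset.univ
  simp only [Finset.mem_univ, Set.iInter_true, Measure.real] at h
  rw [← ENNReal.toReal_prod] at h
  exact (ENNReal.toReal_eq_toReal_iff' (measure_ne_top _ _)
    (ENNReal.prod_ne_top fun i _ => measure_ne_top _ _)).1 h
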